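/- Let $n,d,s\ge 1$ be integers and $\sigma>0$. Let $\mathcal P_{s,d}=\{N(\theta,\sigma^2 I_{d\times d}) : \theta\in\mathbb R^d,\ \|\theta\|_0\le s\}$ be the $s$-sparse Gaussian location family, where $\|\theta\|_0$ denotes the number of non-zero entries of $\theta$, and for $P\in\mathcal P_{s,d}$ let $\theta(P)$ denote its mean. Define the minimax risk in squared Euclidean norm by $$\mathfrak M_n\big(\theta(\mathcal P_{s,d}),\|\cdot\|_2^2\big)=\inf_{\hat\theta}\ \sup_{P\in\mathcal P_{s,d}}\mathbb E_P\Big[\big\|\hat\theta(X_1,\dots,X_n)-\theta(P)\big\|_2^2\Big],$$ where $X_1,\dots,X_n$ are i.i.d. with distribution $P$ and the infimum ranges over all measurable functions $\hat\theta:(\mathbb R^d)^n\to\mathbb R^d$. Then there is a universal constant $c>0$, independent of $n,d,s$ and $\sigma$, such that for all such $n,d,s,\sigma$, $$\mathfrak M_n\big(\theta(\mathcal P_{s,d}),\|\cdot\|_2^2\big)\ \ge\ c\,\frac{\sigma^2\, s\,\log(d/s)}{n}.$$ -/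

import Mathlib

open MeasureTheory ProbabilityTheory
open scoped NNReal ENNReal

noncomputable section

/-- The risk `E_P[Φ(ρ(est(X₁,…,Xₙ), θ(P)))]` of an estimator `est`, where `X₁,…,Xₙ` are i.i.d.
with distribution `P` (so that the sample has law `P ⊗ ⋯ ⊗ P`). It takes values in `[0,∞]`. -/
def iidRisk {𝓧 Θ : Type*} [MeasurableSpace 𝓧] (n : ℕ) (θ : Measure 𝓧 → Θ)
    (Φ : ℝ≥0 → ℝ≥0) (ρ : Θ → Θ → ℝ≥0) (est : (Fin n → 𝓧) → Θ) (P : Measure 𝓧) : ℝ≥0∞ :=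
  ∫⁻ x, (Φ (ρ (est x) (θ P)) : ℝ≥0∞) ∂(Measure.pi fun _ : Fin n => P)

/-- The minimax risk, based on `n` i.i.d. observations, for estimating the parameter `θ(P)` over
the family `𝓕`: the infimum over all measurable estimators of the worst-case risk over `𝓕`. -/
def iidMinimaxRisk {𝓧 Θ : Type*} [MeasurableSpace 𝓧] [MeasurableSpace Θ] (n : ℕ)
    (𝓕 : Set (Measure 𝓧)) (θ : Measure 𝓧 → Θ) (Φ : ℝ≥0 → ℝ≥0) (ρ : Θ → Θ → ℝ≥0) : ℝ≥0∞ :=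
  ⨅ (est : (Fin n → 𝓧) → Θ) (_ : Measurable est), ⨆ P ∈ 𝓕, iidRisk n θ Φ ρ est P

/-- The number of non-zero entries of a vector. -/
def l0norm {d : ℕ} (θ : EuclideanSpace ℝ (Fin d)) : ℕ := hammingNorm fun i => θ i

/-- The `s`-sparse Gaussian location family `{N(θ, σ² I) : ‖θ‖₀ ≤ s}` on `ℝᵈ`. -/
def sparseGaussianFamily (s d : ℕ) (σ : ℝ) : Set (Measure (EuclideanSpace ℝ (Fin d))) :=
  {P | ∃ θ : EuclideanSpace ℝ (Fin d), l0norm θ ≤ s ∧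
    P = multivariateGaussian θ (σ ^ 2 • (1 : Matrix (Fin d) (Fin d) ℝ))}

/-- The mean of a distribution on `ℝᵈ`. -/
def meanParam {d : ℕ} (P : Measure (EuclideanSpace ℝ (Fin d))) : EuclideanSpace ℝ (Fin d) :=
  ∫ x, x ∂P

end

/-!
Split `s * m` of the coordinates, `m = ⌊d / s⌋`, into `s` blocks of size `m`. Independently in each
block, let the mean vanish with probability `1 / 2` and otherwise have a single spike of height `r`
at a uniformly chosen position; such a mean is `s`-sparse. The squared error is additive over the
blocks, so, conditioning on the other blocks, it suffices that each block costs `r² / 16` on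
average.

Within a block, let `L` be the average of the `m` likelihood ratios of the samples with and without
a spike. Spikes at different positions are orthogonal, which gives
`∫ L² = 1 + (exp (n r² / σ²) - 1) / m`, and this is at most `2` when `r² = σ² log (1 + m) / n`.
Integrating `L ≤ 1 + L² / 4` over the region where a test decides for a spike then shows that no
test between the two cases has total error below `1 / 2`. The two cases are at distance `r`, and
Markov's inequality turns this testing error into squared error. Finally, `d / s < 1 + m`.
-/

section Assouad

variable {κ Ω : Type*} [Fintype κ] [DecidableEq κ] [Fintype Ω]

theorem sum_sum_update {M : Type*} [AddCommMonoid M] (k : κ) (f : (κ → Ω) → M) :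
    ∑ a, ∑ ω, f (Function.update a k ω) = Fintype.card Ω • ∑ a, f a := by
  let swap : (κ → Ω) × Ω → (κ → Ω) × Ω := fun p => (Function.update p.1 k p.2, p.1 k)
  have hswap : Function.Involutive swap := fun p => by simp [swap]
  calc ∑ a, ∑ ω, f (Function.update a k ω)
      = ∑ p : (κ → Ω) × Ω, f (swap p).1 := (Fintype.sum_prod_type fun p => f (swap p).1).symm
    _ = ∑ p : (κ → Ω) × Ω, f p.1 := Equiv.sum_comp hswap.toPerm fun p => f p.1
    _ = Fintype.card Ω • ∑ a, f a := by
        simp only [Fintype.sum_prod_type_right, Finset.sum_const, Finset.card_univ]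

theorem card_mul_le_iSup_sum_of_le_sum_update [Nonempty Ω] {L : κ → (κ → Ω) → ℝ≥0∞} {q : ℝ≥0∞}
    (hL : ∀ k a, Fintype.card Ω * q ≤ ∑ ω, L k (Function.update a k ω)) :
    Fintype.card κ * q ≤ ⨆ a, ∑ k, L k a := by
  have average_le (k : κ) : Fintype.card (κ → Ω) * q ≤ ∑ a, L k a := by
    rw [← ENNReal.mul_le_mul_iff_right (a := Fintype.card Ω)
      (Nat.cast_ne_zero.mpr Fintype.card_ne_zero) (ENNReal.natCast_ne_top _)]
    calc (Fintype.card Ω : ℝ≥0∞) * (Fintype.card (κ → Ω) * q)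
        = ∑ _a : κ → Ω, Fintype.card Ω * q := by
          rw [Finset.sum_const, Finset.card_univ, nsmul_eq_mul, mul_left_comm]
      _ ≤ ∑ a, ∑ ω, L k (Function.update a k ω) := Finset.sum_le_sum fun a _ => hL k a
      _ = Fintype.card Ω * ∑ a, L k a := by rw [sum_sum_update, nsmul_eq_mul]
  rw [← ENNReal.mul_le_mul_iff_right (a := Fintype.card (κ → Ω))
    (Nat.cast_ne_zero.mpr Fintype.card_ne_zero) (ENNReal.natCast_ne_top _)]
  calc (Fintype.card (κ → Ω) : ℝ≥0∞) * (Fintype.card κ * q)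
      = ∑ _k : κ, Fintype.card (κ → Ω) * q := by
        rw [Finset.sum_const, Finset.card_univ, nsmul_eq_mul, mul_left_comm]
    _ ≤ ∑ k, ∑ a, L k a := Finset.sum_le_sum fun k _ => average_le k
    _ = ∑ a, ∑ k, L k a := Finset.sum_comm
    _ ≤ ∑ _a : κ → Ω, ⨆ a, ∑ k, L k a :=
        Finset.sum_le_sum fun a _ => le_iSup (fun a => ∑ k, L k a) a
    _ = Fintype.card (κ → Ω) * ⨆ a, ∑ k, L k a := by
        rw [Finset.sum_const, Finset.card_univ, nsmul_eq_mul]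

end Assouad

section MixtureTesting

theorem four_mul_mul_le_add_sq (c x : ℝ≥0∞) : 4 * (c * x) ≤ 4 * c ^ 2 + x ^ 2 := by
  induction c with
  | top => simp
  | coe c =>
    induction x with
    | top => simp
    | coe x =>
      have h := two_mul_le_add_sq (2 * c) x
      rw [mul_pow] at h
      norm_num at h
      have e : 2 * (2 * c) * x = 4 * (c * x) := by ring
      rw [e] at h
      exact_mod_cast h

variable {Y ι E : Type*} [MeasurableSpace Y] {ν : Measure Y} [Fintype ι] [DecidableEq ι]
  {F : ι → Y → ℝ≥0∞}

-- `∫ f ≤ c ν(A) + ∫_{Aᶜ} f + ∫ f² / (4 c)`, cleared of the denominator `c`.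
theorem four_mul_lintegral_le (c : ℝ≥0∞) {f : Y → ℝ≥0∞} (hf : Measurable f) {A : Set Y}
    (hA : MeasurableSet A) :
    4 * (c * ∫⁻ x, f x ∂ν) ≤
      4 * (c ^ 2 * ν A + c * ∫⁻ x in Aᶜ, f x ∂ν) + ∫⁻ x, f x ^ 2 ∂ν := by
  have h_on : 4 * (c * ∫⁻ x in A, f x ∂ν) ≤ 4 * c ^ 2 * ν A + ∫⁻ x, f x ^ 2 ∂ν :=
    calc 4 * (c * ∫⁻ x in A, f x ∂ν)
        = ∫⁻ x in A, 4 * (c * f x) ∂ν := by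
          rw [lintegral_const_mul _ (by fun_prop), lintegral_const_mul _ hf]
      _ ≤ ∫⁻ x in A, 4 * c ^ 2 + f x ^ 2 ∂ν :=
          lintegral_mono fun x => four_mul_mul_le_add_sq c (f x)
      _ = 4 * c ^ 2 * ν A + ∫⁻ x in A, f x ^ 2 ∂ν := by
          rw [lintegral_add_left measurable_const, setLIntegral_const]
      _ ≤ 4 * c ^ 2 * ν A + ∫⁻ x, f x ^ 2 ∂ν := by gcongr; exact Measure.restrict_le_self
  calc 4 * (c * ∫⁻ x, f x ∂ν)
      = 4 * (c * ∫⁻ x in A, f x ∂ν) + 4 * (c * ∫⁻ x in Aᶜ, f x ∂ν) := by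
        rw [← lintegral_add_compl f hA]
        ring
    _ ≤ 4 * c ^ 2 * ν A + ∫⁻ x, f x ^ 2 ∂ν + 4 * (c * ∫⁻ x in Aᶜ, f x ∂ν) := by gcongr
    _ = _ := by ring

theorem lintegral_sum_sq_le (hF : ∀ j, Measurable (F j))
    (hFF : ∀ i j, ∫⁻ x, F i x * F j x ∂ν ≤ 1 + if i = j then (Fintype.card ι : ℝ≥0∞) else 0) :
    ∫⁻ x, (∑ j, F j x) ^ 2 ∂ν ≤ 2 * (Fintype.card ι : ℝ≥0∞) ^ 2 :=
  calc ∫⁻ x, (∑ j, F j x) ^ 2 ∂ν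
      = ∑ i, ∑ j, ∫⁻ x, F i x * F j x ∂ν := by
        simp_rw [sq, Finset.sum_mul_sum]
        rw [lintegral_finsetSum _ fun i _ => by fun_prop]
        exact Finset.sum_congr rfl fun i _ => lintegral_finsetSum _ fun j _ => by fun_prop
    _ ≤ ∑ i, ∑ j, (1 + if i = j then (Fintype.card ι : ℝ≥0∞) else 0) := by
        gcongr with i _ j _
        exact hFF i j
    _ = 2 * (Fintype.card ι : ℝ≥0∞) ^ 2 := by
        simp only [Finset.sum_add_distrib, Finset.sum_const, Finset.sum_ite_eq, Finset.mem_univ,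
          if_true, Finset.card_univ, nsmul_eq_mul, mul_one]
        ring

-- The test `A` of `ν` against the uniform mixture of the `ν.withDensity (F j)` has total error at
-- least `1 / 2`.
theorem card_le_two_mul_sum_measure_add_withDensity_compl (hF : ∀ j, Measurable (F j))
    (hF1 : ∀ j, ∫⁻ x, F j x ∂ν = 1)
    (hFF : ∀ i j, ∫⁻ x, F i x * F j x ∂ν ≤ 1 + if i = j then (Fintype.card ι : ℝ≥0∞) else 0)
    {A : Set Y} (hA : MeasurableSet A) :
    (Fintype.card ι : ℝ≥0∞) ≤ 2 * ∑ j, (ν A + ν.withDensity (F j) Aᶜ) := by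
  rcases isEmpty_or_nonempty ι with _ | _
  · simp
  set m := (Fintype.card ι : ℝ≥0∞) with hm
  have hm0 : m ≠ 0 := Nat.cast_ne_zero.mpr Fintype.card_ne_zero
  set errors := ∑ j, (ν A + ν.withDensity (F j) Aᶜ) with h_errors
  have total_mass : ∫⁻ x, ∑ j, F j x ∂ν = m := by
    rw [lintegral_finsetSum _ fun j _ => hF j]
    simp [hF1, hm]
  have errors_eq : errors = m * ν A + ∫⁻ x in Aᶜ, ∑ j, F j x ∂ν := by
    rw [h_errors, lintegral_finsetSum _ fun j _ => hF j]
    simp [Finset.sum_add_distrib, withDensity_apply _ hA.compl, hm]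
  have key : 2 * m ^ 2 + 2 * m ^ 2 ≤ 4 * (m * errors) + 2 * m ^ 2 :=
    calc 2 * m ^ 2 + 2 * m ^ 2
        = 4 * (m * ∫⁻ x, ∑ j, F j x ∂ν) := by rw [total_mass]; ring
      _ ≤ 4 * (m ^ 2 * ν A + m * ∫⁻ x in Aᶜ, ∑ j, F j x ∂ν) + ∫⁻ x, (∑ j, F j x) ^ 2 ∂ν :=
          four_mul_lintegral_le m (by fun_prop) hA
      _ = 4 * (m * errors) + ∫⁻ x, (∑ j, F j x) ^ 2 ∂ν := by rw [errors_eq]; ring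
      _ ≤ 4 * (m * errors) + 2 * m ^ 2 := by gcongr; exact lintegral_sum_sq_le hF hFF
  have h_cancel : 2 * m * m ≤ 2 * m * (2 * errors) := by
    have := (ENNReal.add_le_add_iff_right (by finiteness)).mp key
    calc 2 * m * m = 2 * m ^ 2 := by ring
      _ ≤ 4 * (m * errors) := this
      _ = 2 * m * (2 * errors) := by ring
  exact (ENNReal.mul_le_mul_iff_right (by simp [hm0]) (by finiteness)).mp h_cancel

variable [PseudoEMetricSpace E] [MeasurableSpace E] [OpensMeasurableSpace E]

theorem card_mul_le_two_mul_sum_lintegral_edist (hF : ∀ j, Measurable (F j))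
    (hF1 : ∀ j, ∫⁻ x, F j x ∂ν = 1)
    (hFF : ∀ i j, ∫⁻ x, F i x * F j x ∂ν ≤ 1 + if i = j then (Fintype.card ι : ℝ≥0∞) else 0)
    {t : Y → E} (ht : Measurable t) {p : E} {q : ι → E} {ρ : ℝ≥0∞}
    (hpq : ∀ j, 2 * ρ ≤ edist p (q j)) {Φ : ℝ≥0∞ → ℝ≥0∞} (hΦ : Monotone Φ) :
    Fintype.card ι * Φ ρ ≤
      2 * ∑ j, (∫⁻ x, Φ (edist (t x) p) ∂ν +
        ∫⁻ x, Φ (edist (t x) (q j)) ∂ν.withDensity (F j)) := by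
  have hdist (u : E) : Measurable fun x => edist (t x) u := measurable_edist_left.comp ht
  have markov (μ : Measure Y) (u : E) :
      μ {x | ρ ≤ edist (t x) u} * Φ ρ ≤ ∫⁻ x, Φ (edist (t x) u) ∂μ :=
    calc μ {x | ρ ≤ edist (t x) u} * Φ ρ ≤ Φ ρ * μ {x | Φ ρ ≤ Φ (edist (t x) u)} := by
          rw [mul_comm]
          exact mul_le_mul_right (measure_mono fun _ hx => hΦ hx) _
      _ ≤ ∫⁻ x, Φ (edist (t x) u) ∂μ :=
          mul_meas_ge_le_lintegral (hΦ.measurable.comp (hdist u)) _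
  set A := {x | ρ ≤ edist (t x) p}
  have compl_subset (j : ι) : Aᶜ ⊆ {x | ρ ≤ edist (t x) (q j)} := by
    intro x hx
    by_contra hxj
    have : edist p (q j) < ρ + ρ :=
      (edist_triangle_left p (q j) (t x)).trans_lt
        (ENNReal.add_lt_add (not_le.mp hx) (not_le.mp hxj))
    exact this.not_ge (two_mul ρ ▸ hpq j)
  calc Fintype.card ι * Φ ρ
      ≤ 2 * (∑ j, (ν A + ν.withDensity (F j) Aᶜ)) * Φ ρ := by
        gcongr
        exact card_le_two_mul_sum_measure_add_withDensity_compl hF hF1 hFF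
          (measurableSet_le measurable_const (hdist p))
    _ = 2 * ∑ j, (ν A * Φ ρ + ν.withDensity (F j) Aᶜ * Φ ρ) := by
        simp_rw [mul_assoc, Finset.sum_mul, add_mul]
    _ ≤ _ := by
        gcongr with j
        · exact markov ν p
        · exact (mul_le_mul_left (measure_mono (compl_subset j)) _).trans (markov _ (q j))

end MixtureTesting

section ProductMeasures

theorem lintegral_pi_prod_eq_prod_lintegral {ι : Type*} [Fintype ι] {α : ι → Type*}
    [∀ i, MeasurableSpace (α i)] (μ : ∀ i, Measure (α i)) [∀ i, IsProbabilityMeasure (μ i)]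
    {f : ∀ i, α i → ℝ≥0∞} (hf : ∀ i, Measurable (f i)) :
    ∫⁻ x, ∏ i, f i (x i) ∂Measure.pi μ = ∏ i, ∫⁻ y, f i y ∂μ i := by
  have h := lintegral_prod_eq_prod_lintegral_of_indepFun (μ := Measure.pi μ) Finset.univ
    (fun i x => f i (x i)) (iIndepFun_pi fun i => (hf i).aemeasurable)
    fun i => (hf i).comp (measurable_pi_apply i)
  rw [h]
  exact Finset.prod_congr rfl fun i _ => (measurePreserving_eval μ i).lintegral_comp (hf i)

theorem pi_withDensity {ι : Type*} [Fintype ι] {α : ι → Type*}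
    [∀ i, MeasurableSpace (α i)] (μ : ∀ i, Measure (α i)) [∀ i, IsProbabilityMeasure (μ i)]
    {f : ∀ i, α i → ℝ≥0∞} (hf : ∀ i, Measurable (f i))
    [∀ i, SigmaFinite ((μ i).withDensity (f i))] :
    Measure.pi (fun i => (μ i).withDensity (f i)) =
      (Measure.pi μ).withDensity fun x => ∏ i, f i (x i) := by
  classical
  refine Measure.pi_eq fun s hs => ?_
  have indicator_prod (x : ∀ i, α i) :
      (Set.univ.pi s).indicator (fun x => ∏ i, f i (x i)) x =
        ∏ i, (s i).indicator (f i) (x i) := by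
    simp only [Set.indicator_apply, Set.mem_univ_pi, Fintype.prod_ite_zero]
  rw [withDensity_apply _ (.univ_pi hs), ← lintegral_indicator (.univ_pi hs)]
  simp_rw [indicator_prod]
  rw [lintegral_pi_prod_eq_prod_lintegral μ fun i => (hf i).indicator (hs i)]
  exact Finset.prod_congr rfl fun i _ => by
    rw [lintegral_indicator (hs i), withDensity_apply _ (hs i)]

theorem map_withDensity_comp {α β : Type*} [MeasurableSpace α] [MeasurableSpace β]
    (μ : Measure α) {g : α → β} (hg : Measurable g) {f : β → ℝ≥0∞} (hf : Measurable f) :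
    (μ.withDensity (f ∘ g)).map g = (μ.map g).withDensity f := by
  ext s hs
  rw [Measure.map_apply hg hs, withDensity_apply _ (hg hs), withDensity_apply _ hs,
    setLIntegral_map hs hf hg]
  rfl

variable {𝓧 ι E : Type*} [MeasurableSpace 𝓧] [Fintype ι] [DecidableEq ι]
  [PseudoEMetricSpace E] [MeasurableSpace E] [OpensMeasurableSpace E]

theorem card_mul_le_two_mul_sum_lintegral_edist_pi (n : ℕ) {μ : Measure 𝓧}
    [IsProbabilityMeasure μ] {f : ι → 𝓧 → ℝ≥0∞} (hf : ∀ j, Measurable (f j))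
    (hf1 : ∀ j, ∫⁻ x, f j x ∂μ = 1)
    (hff : ∀ i j, (∫⁻ x, f i x * f j x ∂μ) ^ n ≤
      1 + if i = j then (Fintype.card ι : ℝ≥0∞) else 0)
    {t : (Fin n → 𝓧) → E} (ht : Measurable t) {p : E} {q : ι → E} {ρ : ℝ≥0∞}
    (hpq : ∀ j, 2 * ρ ≤ edist p (q j)) {Φ : ℝ≥0∞ → ℝ≥0∞} (hΦ : Monotone Φ) :
    Fintype.card ι * Φ ρ ≤
      2 * ∑ j, (∫⁻ x, Φ (edist (t x) p) ∂Measure.pi (fun _ => μ) +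
        ∫⁻ x, Φ (edist (t x) (q j)) ∂Measure.pi fun _ => μ.withDensity (f j)) := by
  have (j : ι) : IsFiniteMeasure (μ.withDensity (f j)) :=
    isFiniteMeasure_withDensity (by simp [hf1])
  simp_rw [pi_withDensity (fun _ : Fin n => μ) fun _ => hf _]
  refine card_mul_le_two_mul_sum_lintegral_edist (fun j => by fun_prop) (fun j => ?_)
    (fun i j => ?_) ht hpq hΦ
  · rw [lintegral_pi_prod_eq_prod_lintegral _ fun _ => hf j]
    simp [hf1]
  · simp_rw [← Finset.prod_mul_distrib]
    rw [lintegral_pi_prod_eq_prod_lintegral (f := fun _ x => f i x * f j x) _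
      fun _ => (hf i).mul (hf j)]
    simpa using hff i j

end ProductMeasures

section GaussianShift

variable {ι : Type*} [Fintype ι]

theorem gaussianReal_add_eq_withDensity (θ δ : ℝ) {v : ℝ≥0} (hv : v ≠ 0) :
    gaussianReal (θ + δ) v = (gaussianReal θ v).withDensity
      fun x => ENNReal.ofReal (Real.exp (δ * (x - θ) / v - δ ^ 2 / (2 * v))) := by
  rw [gaussianReal_of_var_ne_zero _ hv, gaussianReal_of_var_ne_zero _ hv,
    ← withDensity_mul _ (measurable_gaussianPDF _ _) (by fun_prop)]
  congr 1
  ext x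
  simp only [Pi.mul_apply, gaussianPDF, gaussianPDFReal]
  rw [← ENNReal.ofReal_mul (by positivity), mul_assoc _ (Real.exp _) (Real.exp _), ← Real.exp_add]
  congr 3
  field_simp
  ring

/-- The likelihood ratio of `N(θ + δ, σ² I)` with respect to `N(θ, σ² I)`. -/
noncomputable def gaussianLikelihoodRatio (σ : ℝ) (θ δ x : EuclideanSpace ℝ ι) : ℝ≥0∞ :=
  ENNReal.ofReal (Real.exp (inner ℝ δ (x - θ) / σ ^ 2 - ‖δ‖ ^ 2 / (2 * σ ^ 2)))

theorem measurable_gaussianLikelihoodRatio (σ : ℝ) (θ δ : EuclideanSpace ℝ ι) :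
    Measurable (gaussianLikelihoodRatio σ θ δ) := by
  unfold gaussianLikelihoodRatio
  fun_prop

theorem gaussianLikelihoodRatio_mul (σ : ℝ) (θ δ δ' x : EuclideanSpace ℝ ι) :
    gaussianLikelihoodRatio σ θ δ x * gaussianLikelihoodRatio σ θ δ' x =
      ENNReal.ofReal (Real.exp (inner ℝ δ δ' / σ ^ 2)) *
        gaussianLikelihoodRatio σ θ (δ + δ') x := by
  simp only [gaussianLikelihoodRatio]
  rw [← ENNReal.ofReal_mul (Real.exp_nonneg _), ← ENNReal.ofReal_mul (Real.exp_nonneg _),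
    ← Real.exp_add, ← Real.exp_add, norm_add_sq_real, inner_add_left]
  ring_nf

theorem gaussianLikelihoodRatio_eq_prod (σ : ℝ) (θ δ x : EuclideanSpace ℝ ι) :
    gaussianLikelihoodRatio σ θ δ x =
      ∏ i, ENNReal.ofReal (Real.exp (δ i * (x i - θ i) / σ ^ 2 - δ i ^ 2 / (2 * σ ^ 2))) := by
  rw [← ENNReal.ofReal_prod_of_nonneg fun _ _ => Real.exp_nonneg _, ← Real.exp_sum,
    Finset.sum_sub_distrib, ← Finset.sum_div, ← Finset.sum_div, gaussianLikelihoodRatio,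
    EuclideanSpace.real_norm_sq_eq]
  simp only [PiLp.inner_apply, PiLp.sub_apply, RCLike.inner_apply, conj_trivial, mul_comm]

variable [DecidableEq ι]

/-- The isotropic Gaussian distribution `N(θ, σ² I)`. -/
noncomputable abbrev isotropicGaussian (σ : ℝ) (θ : EuclideanSpace ℝ ι) :
    Measure (EuclideanSpace ℝ ι) :=
  multivariateGaussian θ (σ ^ 2 • (1 : Matrix ι ι ℝ))

theorem isotropicGaussian_eq_map_pi (σ : ℝ) (θ : EuclideanSpace ℝ ι) :
    isotropicGaussian σ θ =
      (Measure.pi fun i => gaussianReal (θ i) (σ ^ 2).toNNReal).map (WithLp.toLp 2) := by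
  apply Measure.ext_of_charFun
  ext u
  have cov_posSemidef : (σ ^ 2 • (1 : Matrix ι ι ℝ)).PosSemidef :=
    Matrix.PosSemidef.one.smul (sq_nonneg σ)
  simp_rw [charFun_multivariateGaussian cov_posSemidef, charFun_pi, charFun_gaussianReal,
    ← Complex.exp_sum]
  congr 1
  simp only [Finset.sum_sub_distrib, Matrix.smul_mulVec, Matrix.one_mulVec, PiLp.inner_apply,
    dotProduct, Pi.smul_apply, smul_eq_mul, Real.coe_toNNReal _ (sq_nonneg σ), RCLike.inner_apply,
    conj_trivial]
  push_cast
  rw [Finset.sum_mul, Finset.sum_div]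
  congr 1 <;> exact Finset.sum_congr rfl fun i _ => by ring

variable {σ : ℝ} (hσ : σ ≠ 0)
include hσ

theorem isotropicGaussian_add_eq_withDensity (θ δ : EuclideanSpace ℝ ι) :
    isotropicGaussian σ (θ + δ) =
      (isotropicGaussian σ θ).withDensity (gaussianLikelihoodRatio σ θ δ) := by
  have hv : (σ ^ 2).toNNReal ≠ 0 := (Real.toNNReal_pos.mpr (by positivity)).ne'
  have coord_shift (i : ι) := gaussianReal_add_eq_withDensity (θ i) (δ i) hv
  simp_rw [Real.coe_toNNReal _ (sq_nonneg σ)] at coord_shift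
  have (i : ι) := coord_shift i ▸
    (inferInstance : SigmaFinite (gaussianReal (θ i + δ i) (σ ^ 2).toNNReal))
  rw [isotropicGaussian_eq_map_pi, isotropicGaussian_eq_map_pi,
    ← map_withDensity_comp _ (by fun_prop) (measurable_gaussianLikelihoodRatio σ θ δ)]
  simp_rw [PiLp.add_apply, coord_shift]
  rw [pi_withDensity _ fun i => by fun_prop]
  congr 2
  ext x
  exact (gaussianLikelihoodRatio_eq_prod σ θ δ _).symm

theorem lintegral_gaussianLikelihoodRatio (θ δ : EuclideanSpace ℝ ι) :
    ∫⁻ x, gaussianLikelihoodRatio σ θ δ x ∂isotropicGaussian σ θ = 1 := by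
  rw [← setLIntegral_univ, ← withDensity_apply _ .univ, ← isotropicGaussian_add_eq_withDensity hσ,
    measure_univ]

theorem lintegral_gaussianLikelihoodRatio_mul (θ δ δ' : EuclideanSpace ℝ ι) :
    ∫⁻ x, gaussianLikelihoodRatio σ θ δ x * gaussianLikelihoodRatio σ θ δ' x
        ∂isotropicGaussian σ θ =
      ENNReal.ofReal (Real.exp (inner ℝ δ δ' / σ ^ 2)) := by
  simp_rw [gaussianLikelihoodRatio_mul]
  rw [lintegral_const_mul _ (measurable_gaussianLikelihoodRatio σ θ _),
    lintegral_gaussianLikelihoodRatio hσ, mul_one]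

theorem card_mul_le_two_mul_sum_lintegral_edist_isotropicGaussian {κ E : Type*} [Fintype κ]
    [PseudoEMetricSpace E] [MeasurableSpace E] [OpensMeasurableSpace E] {n : ℕ} {r : ℝ}
    (hr : Real.exp (n * (r ^ 2 / σ ^ 2)) ≤ 1 + Fintype.card κ) (θ : EuclideanSpace ℝ ι)
    {δ : κ → EuclideanSpace ℝ ι} (hδ_norm : ∀ j, ‖δ j‖ = r)
    (hδ_orth : Pairwise fun i j => inner ℝ (δ i) (δ j) = 0)
    {t : (Fin n → EuclideanSpace ℝ ι) → E} (ht : Measurable t) {p : E} {q : κ → E} {ρ : ℝ≥0∞}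
    (hpq : ∀ j, 2 * ρ ≤ edist p (q j)) {Φ : ℝ≥0∞ → ℝ≥0∞} (hΦ : Monotone Φ) :
    Fintype.card κ * Φ ρ ≤
      2 * ∑ j, (∫⁻ x, Φ (edist (t x) p) ∂Measure.pi (fun _ => isotropicGaussian σ θ) +
        ∫⁻ x, Φ (edist (t x) (q j)) ∂Measure.pi fun _ => isotropicGaussian σ (θ + δ j)) := by
  classical
  simp_rw [isotropicGaussian_add_eq_withDensity hσ θ]
  refine card_mul_le_two_mul_sum_lintegral_edist_pi n
    (fun j => measurable_gaussianLikelihoodRatio σ θ (δ j))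
    (fun j => lintegral_gaussianLikelihoodRatio hσ θ (δ j)) (fun i j => ?_) ht hpq hΦ
  rw [lintegral_gaussianLikelihoodRatio_mul hσ, ← ENNReal.ofReal_pow (Real.exp_nonneg _),
    ← Real.exp_nat_mul]
  split_ifs with hij
  · subst hij
    rw [real_inner_self_eq_norm_sq, hδ_norm]
    refine ENNReal.ofReal_le_of_le_toReal (hr.trans_eq ?_)
    rw [ENNReal.toReal_add ENNReal.one_ne_top (ENNReal.natCast_ne_top _), ENNReal.toReal_one,
      ENNReal.toReal_natCast]
  · simp [hδ_orth hij]

end GaussianShift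

section SparseSpikes

theorem edist_sq_eq_sum {ν : Type*} [Fintype ν] (u v : EuclideanSpace ℝ ν) :
    edist u v ^ 2 = ∑ i, edist (u i) (v i) ^ 2 := by
  rw [EuclideanSpace.edist_eq, ← ENNReal.rpow_mul_natCast]
  simp

variable {κ ι : Type*} {d n : ℕ}

/-- The restriction of a vector to the coordinates of block `k`. -/
def block (e : κ × ι ↪ Fin d) (k : κ) (y : EuclideanSpace ℝ (Fin d)) : EuclideanSpace ℝ ι :=
  WithLp.toLp 2 fun l => y (e (k, l))

theorem measurable_block (e : κ × ι ↪ Fin d) (k : κ) : Measurable (block e k) := by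
  unfold block
  fun_prop

theorem block_add_single [DecidableEq ι] (e : κ × ι ↪ Fin d) (k : κ) (j : ι) (r : ℝ)
    (θ : EuclideanSpace ℝ (Fin d)) :
    block e k (θ + EuclideanSpace.single (e (k, j)) r) =
      block e k θ + EuclideanSpace.single j r := by
  ext l
  simp [block, PiLp.single_apply]

/-- The spike contributed by block `k`, where `e` lays out the blocks `{k} × ι` as disjoint sets of
coordinates: the flag `ω.1` says whether there is a spike and `ω.2` is its position. The position
is kept when the flag is unset, so that a uniform `ω` puts mass `1 / 2` on the zero vector. -/
noncomputable def spike (e : κ × ι ↪ Fin d) (r : ℝ) (k : κ) (ω : Bool × ι) :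
    EuclideanSpace ℝ (Fin d) :=
  if ω.1 then EuclideanSpace.single (e (k, ω.2)) r else 0

variable [Fintype κ]

/-- The hypothesis indexed by `a`: the vector with at most one spike in each block. -/
noncomputable def spikes (e : κ × ι ↪ Fin d) (r : ℝ) (a : κ → Bool × ι) :
    EuclideanSpace ℝ (Fin d) :=
  ∑ k, spike e r k (a k)

theorem spikes_update [DecidableEq κ] (e : κ × ι ↪ Fin d) (r : ℝ) (a : κ → Bool × ι) (k : κ)
    (ω : Bool × ι) :
    spikes e r (Function.update a k ω) = ∑ k' ∈ {k}ᶜ, spike e r k' (a k') + spike e r k ω := by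
  rw [spikes, Fintype.sum_eq_add_sum_compl k, add_comm, Function.update_self]
  congr 1
  refine Finset.sum_congr rfl fun k' hk' => ?_
  rw [Function.update_of_ne (by simpa using hk')]

theorem l0norm_spikes_le (e : κ × ι ↪ Fin d) (r : ℝ) (a : κ → Bool × ι) :
    l0norm (spikes e r a) ≤ Fintype.card κ := by
  classical
  have support_subset : ({i | spikes e r a i ≠ 0} : Finset (Fin d)) ⊆
      Finset.univ.image fun k => e (k, (a k).2) := by
    intro i hi
    rw [Finset.mem_filter_univ, spikes, WithLp.ofLp_sum, Finset.sum_apply] at hi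
    obtain ⟨k, -, hk⟩ := Finset.exists_ne_zero_of_sum_ne_zero hi
    refine Finset.mem_image.mpr ⟨k, Finset.mem_univ k, ?_⟩
    by_contra! hne
    refine hk ?_
    unfold spike
    split_ifs <;> simp [hne.symm]
  exact (Finset.card_le_card support_subset).trans Finset.card_image_le

variable [Fintype ι]

theorem sum_edist_block_sq_le (e : κ × ι ↪ Fin d) (y θ : EuclideanSpace ℝ (Fin d)) :
    ∑ k, edist (block e k y) (block e k θ) ^ 2 ≤ edist y θ ^ 2 := by
  simp_rw [edist_sq_eq_sum]
  calc ∑ k, ∑ l, edist (y (e (k, l))) (θ (e (k, l))) ^ 2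
      = ∑ i ∈ Finset.univ.map e, edist (y i) (θ i) ^ 2 := by
        rw [Finset.sum_map, Fintype.sum_prod_type]
    _ ≤ ∑ i, edist (y i) (θ i) ^ 2 :=
        Finset.sum_le_sum_of_subset (Finset.subset_univ _)

/-- The contribution of block `k` to the squared error risk at mean `θ` of an estimator. -/
noncomputable def blockRisk (e : κ × ι ↪ Fin d) (σ : ℝ)
    (est : (Fin n → EuclideanSpace ℝ (Fin d)) → EuclideanSpace ℝ (Fin d)) (k : κ)
    (θ : EuclideanSpace ℝ (Fin d)) : ℝ≥0∞ :=
  ∫⁻ x, edist (block e k (est x)) (block e k θ) ^ 2 ∂Measure.pi fun _ => isotropicGaussian σ θ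

variable {σ r : ℝ}
  {est : (Fin n → EuclideanSpace ℝ (Fin d)) → EuclideanSpace ℝ (Fin d)}

theorem sum_blockRisk_le_iidRisk (e : κ × ι ↪ Fin d) (hest : Measurable est)
    (θ : EuclideanSpace ℝ (Fin d)) :
    ∑ k, blockRisk e σ est k θ ≤
      iidRisk n meanParam (fun t => t ^ 2) nndist est (isotropicGaussian σ θ) := by
  have h_meas (k : κ) : Measurable fun x => edist (block e k (est x)) (block e k θ) ^ 2 :=
    (measurable_edist_left.comp ((measurable_block e k).comp hest)).pow_const 2
  simp_rw [blockRisk, iidRisk, meanParam, integral_id_multivariateGaussian, ENNReal.coe_pow,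
    ← edist_nndist]
  rw [← lintegral_finsetSum _ fun k _ => h_meas k]
  exact lintegral_mono fun x => sum_edist_block_sq_le e (est x) θ

theorem card_mul_le_sum_blockRisk_spikes [DecidableEq κ] (e : κ × ι ↪ Fin d) (hσ : σ ≠ 0)
    (hr : 0 ≤ r) (hexp : Real.exp (n * (r ^ 2 / σ ^ 2)) ≤ 1 + Fintype.card ι)
    (hest : Measurable est) (k : κ) (a : κ → Bool × ι) :
    Fintype.card (Bool × ι) * ENNReal.ofReal (r ^ 2 / 16) ≤
      ∑ ω, blockRisk e σ est k (spikes e r (Function.update a k ω)) := by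
  classical
  set θ := ∑ k' ∈ {k}ᶜ, spike e r k' (a k')
  let δ (j : ι) : EuclideanSpace ℝ (Fin d) := EuclideanSpace.single (e (k, j)) r
  have δ_orth : Pairwise fun i j => inner ℝ (δ i) (δ j) = 0 := fun i j hij => by
    simp [δ, EuclideanSpace.inner_single_left, hij]
  have separated (j : ι) :
      2 * ENNReal.ofReal (r / 2) ≤ edist (block e k θ) (block e k (θ + δ j)) := by
    rw [block_add_single, edist_dist, dist_self_add_right, PiLp.norm_single,
      Real.norm_of_nonneg hr, ← ENNReal.ofReal_ofNat, ← ENNReal.ofReal_mul zero_le_two]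
    exact (congrArg _ (by ring)).le
  have mixture_bound : Fintype.card ι * ENNReal.ofReal (r / 2) ^ 2 ≤
      2 * ∑ j, (blockRisk e σ est k θ + blockRisk e σ est k (θ + δ j)) :=
    card_mul_le_two_mul_sum_lintegral_edist_isotropicGaussian hσ hexp θ
      (fun j => by simp [δ, abs_of_nonneg hr]) δ_orth ((measurable_block e k).comp hest) separated
      (Φ := (· ^ 2)) (pow_left_mono 2)
  have sum_eq : ∑ ω, blockRisk e σ est k (spikes e r (Function.update a k ω)) =
      ∑ j, (blockRisk e σ est k θ + blockRisk e σ est k (θ + δ j)) := by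
    simp_rw [spikes_update, Fintype.sum_prod_type_right, Fintype.sum_bool]
    simp [spike, θ, δ, add_comm]
  have scale : 2 * (Fintype.card (Bool × ι) * ENNReal.ofReal (r ^ 2 / 16)) =
      Fintype.card ι * ENNReal.ofReal (r / 2) ^ 2 := by
    rw [← ENNReal.ofReal_pow (by positivity), show (r / 2) ^ 2 = 4 * (r ^ 2 / 16) by ring,
      ENNReal.ofReal_mul (by norm_num), ENNReal.ofReal_ofNat, Fintype.card_prod,
      Fintype.card_bool]
    push_cast
    ring
  rw [sum_eq, ← ENNReal.mul_le_mul_iff_right two_ne_zero ENNReal.ofNat_ne_top, scale]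
  exact mixture_bound

theorem card_mul_le_iidMinimaxRisk_sparseGaussianFamily [Nonempty ι] (e : κ × ι ↪ Fin d)
    (hσ : σ ≠ 0) (hr : 0 ≤ r) (hexp : Real.exp (n * (r ^ 2 / σ ^ 2)) ≤ 1 + Fintype.card ι) :
    Fintype.card κ * ENNReal.ofReal (r ^ 2 / 16) ≤
      iidMinimaxRisk n (sparseGaussianFamily (Fintype.card κ) d σ) meanParam
        (fun t => t ^ 2) nndist := by
  classical
  refine le_iInf₂ fun est hest => ?_
  calc Fintype.card κ * ENNReal.ofReal (r ^ 2 / 16)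
      ≤ ⨆ a, ∑ k, blockRisk e σ est k (spikes e r a) :=
        card_mul_le_iSup_sum_of_le_sum_update
          (card_mul_le_sum_blockRisk_spikes e hσ hr hexp hest)
    _ ≤ ⨆ a, iidRisk n meanParam (fun t => t ^ 2) nndist est
          (isotropicGaussian σ (spikes e r a)) :=
        iSup_mono fun a => sum_blockRisk_le_iidRisk e hest (spikes e r a)
    _ ≤ ⨆ P ∈ sparseGaussianFamily (Fintype.card κ) d σ,
          iidRisk n meanParam (fun t => t ^ 2) nndist est P :=
        iSup_le fun a => le_iSup₂_of_le _ ⟨spikes e r a, l0norm_spikes_le e r a, rfl⟩ le_rfl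

end SparseSpikes

theorem mul_log_le_iidMinimaxRisk_sparseGaussianFamily {n d s m : ℕ} {σ : ℝ} (hn : n ≠ 0)
    (hσ : σ ≠ 0) (hsm : s * m ≤ d) :
    ENNReal.ofReal (s * (σ ^ 2 * Real.log (1 + m) / n / 16)) ≤
      iidMinimaxRisk n (sparseGaussianFamily s d σ) meanParam (fun t => t ^ 2) nndist := by
  rcases eq_or_ne m 0 with rfl | hm
  · simp
  have : NeZero m := ⟨hm⟩
  let e : Fin s × Fin m ↪ Fin d := finProdFinEquiv.toEmbedding.trans (Fin.castLEEmb hsm)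
  have log_nonneg : 0 ≤ Real.log (1 + m) := Real.log_nonneg (by simp)
  set r := √(σ ^ 2 * Real.log (1 + m) / n)
  have r_sq : r ^ 2 = σ ^ 2 * Real.log (1 + m) / n := Real.sq_sqrt (by positivity)
  have exp_eq : Real.exp (n * (r ^ 2 / σ ^ 2)) = 1 + m := by
    rw [r_sq, show n * (σ ^ 2 * Real.log (1 + m) / n / σ ^ 2) = Real.log (1 + m) by field_simp,
      Real.exp_log (by positivity)]
  rw [ENNReal.ofReal_mul (Nat.cast_nonneg s), ENNReal.ofReal_natCast, ← r_sq]
  simpa only [Fintype.card_fin] using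
    card_mul_le_iidMinimaxRisk_sparseGaussianFamily e hσ (Real.sqrt_nonneg _)
      (exp_eq.trans_le (by simp))

theorem corollary3 :
    ∃ c : ℝ, 0 < c ∧ ∀ (n d s : ℕ) (σ : ℝ), 0 < n → 0 < d → 0 < s → 0 < σ →
      ENNReal.ofReal (c * (σ ^ 2 * s * Real.log (d / s) / n)) ≤
        iidMinimaxRisk n (sparseGaussianFamily s d σ) meanParam (fun t => t ^ 2) nndist := by
  refine ⟨1 / 16, by norm_num, fun n d s σ hn hd hs hσ => ?_⟩
  calc ENNReal.ofReal (1 / 16 * (σ ^ 2 * s * Real.log (d / s) / n))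
      ≤ ENNReal.ofReal (1 / 16 * (σ ^ 2 * s * Real.log (1 + (d / s : ℕ)) / n)) := by
        gcongr
        rw [add_comm, ← Nat.floor_div_eq_div (K := ℝ)]
        exact (Nat.lt_floor_add_one _).le
    _ = ENNReal.ofReal (s * (σ ^ 2 * Real.log (1 + (d / s : ℕ)) / n / 16)) := by
        congr 1
        ring
    _ ≤ iidMinimaxRisk n (sparseGaussianFamily s d σ) meanParam (fun t => t ^ 2) nndist :=
        mul_log_le_iidMinimaxRisk_sparseGaussianFamily hn.ne' hσ.ne' (Nat.mul_div_le d s)
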